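/- Let $\Omega\subset\mathbb{R}^2$ be a nonempty bounded convex open set, let $L\in\mathbb{R}$ and $\rho>0$. There are positive constants $C,C_0,C_1,h_0$, depending only on $\Omega$, $L$ and $\rho$, with the following property. Let $D_1,\dots,D_n$ be pairwise disjoint open connected sets with $\overline\Omega=\bigcup_j\overline{D_j}$ (for instance Lipschitz polygons), and let $\alpha\ge 1$ be a coefficient with $\alpha\in W^{1,\infty}(D_j)$ and $|\alpha|_{1,\infty,D_j}=\max_{i=1,2}\|\partial_i\alpha\|_{L^\infty(D_j)}\le L$ for every $j$ ($\alpha$ being represented by the function that is continuous on each $D_j$). Let $\mathcal T_h$ be a conforming triangulation of $\Omega$ into finitely many closed triangles $K$, $\overline\Omega=\bigcup_K K$, with $h=\max_K \operatorname{diam}K$, such that the interior of no triangle meets any $\partial D_j$, and which is quasiuniform with parameter $\rho$: every triangle contains a disc of diameter at least $\rho h$. In every triangle $K$ choose an interior point $z_K$. Let $V_h$ be the Crouzeix–Raviart space of the functions that are affine on every triangle, continuous at the midpoints $m_e$ of the edges $e$, and zero at the midpoints of the edges contained in $\partial\Omega$. For an interior edge $e$ (an edge with $e\not\subset\partial\Omega$)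 let the control volume $b_e$ be the union of the two triangles spanned by $e$ and $z_K$, where $K$ runs through the two triangles sharing $e$; let $\chi_e$ be its characteristic function, $\mathbf n$ its outer unit normal, and put $I_h^*v=\sum_e v(m_e)\chi_e$, the sum being over the interior edges. Define $$a_h^{FE}(u,v)=\sum_{K\in\mathcal T_h}\int_K\alpha\,\nabla u\cdot\nabla v\,dx,\qquad a_h^{FV}(u,w)=-\sum_{e\text{ interior}}w(m_e)\int_{\partial b_e}\alpha\,\nabla u\cdot\mathbf n\,ds,\qquad \|u\|_a=\sqrt{a_h^{FE}(u,u)} .$$ Then $$|a_h^{FE}(u,v)-a_h^{FV}(u,I_h^*v)|\le C\,h\,\|u\|_a\|v\|_a\qquad\text{for all }u,v\in V_h,$$ $$|a_h^{FV}(u,I_h^*v)|\le C_1\|u\|_a\|v\|_a\qquad\text{for all }u,v\in V_h,$$ and, if $h<h_0$, $$a_h^{FV}(u,I_h^*u)\ge C_0\|u\|_a^2\qquad\text{for all }u\in V_h .$$ -/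

import Mathlib

open MeasureTheory
open scoped ContDiff

namespace CRFVE

noncomputable section

/-- The Euclidean plane. -/
abbrev Plane : Type := EuclideanSpace ℝ (Fin 2)

/-! ### The coefficient -/

/-- `g` is the weak partial derivative of `f` in the `i`-th coordinate direction on the open
set `U`. -/
def IsWeakPartial (U : Set Plane) (i : Fin 2) (f g : Plane → ℝ) : Prop :=
  ∀ φ : Plane → ℝ, ContDiff ℝ ∞ φ → HasCompactSupport φ → tsupport φ ⊆ U →
    ∫ x in U, f x * fderiv ℝ φ x (EuclideanSpace.single i 1) = -∫ x in U, g x * φ x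

/-- `f ∈ W^{1,∞}(U)` with seminorm `|f|_{1,∞,U} = max_i ‖∂_i f‖_{L^∞(U)} ≤ L`. -/
def MemW1InftyWithBound (U : Set Plane) (f : Plane → ℝ) (L : ℝ) : Prop :=
  MemLp f ⊤ (volume.restrict U) ∧
    ∃ g : Fin 2 → Plane → ℝ, ∀ i : Fin 2, IsWeakPartial U i f (g i) ∧
      MemLp (g i) ⊤ (volume.restrict U) ∧
      eLpNorm (g i) ⊤ (volume.restrict U) ≤ ENNReal.ofReal L

/-- `D 0, …, D (n-1)` is a nonoverlapping partitioning of `Ω` into open connected sets. -/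
structure IsPartition (Ω : Set Plane) {n : ℕ} (D : Fin n → Set Plane) : Prop where
  isOpen : ∀ j, IsOpen (D j)
  isConnected : ∀ j, IsConnected (D j)
  disjoint : ∀ i j, i ≠ j → Disjoint (D i) (D j)
  cover : ⋃ j, closure (D j) = closure Ω

/-- The coefficient is bounded below by `1` and belongs to `W^{1,∞}` on every piece `D j`, with
seminorm at most `L`.  The elements of `W^{1,∞}` being classes of functions, `α` stands for the
representative that is continuous on every `D j`, so that its integrals along segments make
sense. -/
structure IsCoefficient {n : ℕ} (D : Fin n → Set Plane) (α : Plane → ℝ) (L : ℝ) : Prop where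
  continuousOn : ∀ j, ContinuousOn α (D j)
  memW : ∀ j, MemW1InftyWithBound (D j) α L
  one_le : ∀ j, ∀ x ∈ D j, 1 ≤ α x

/-! ### Triangulations -/

/-- The closed convex hull of a finite set of vertices (a closed triangle or a closed edge). -/
def hull (s : Finset Plane) : Set Plane := convexHull ℝ (s : Set Plane)

/-- A (conforming, finite) triangulation of `Ω`.  A triangle is given by its set of vertices.
Two triangles meet in their common vertices, common edge, or not at all. -/
structure Triangulation (Ω : Set Plane) where
  cells : Finset (Finset Plane)
  card_eq : ∀ K ∈ cells, K.card = 3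
  indep : ∀ K ∈ cells, AffineIndependent ℝ ((↑) : K → Plane)
  inter_subset : ∀ K ∈ cells, ∀ K' ∈ cells,
    hull K ∩ hull K' ⊆ convexHull ℝ ((K : Set Plane) ∩ (K' : Set Plane))
  cover : ⋃ K ∈ cells, hull K = closure Ω

variable {Ω : Set Plane}

/-- The mesh size `h`, the largest diameter of a triangle. -/
def Triangulation.meshSize (T : Triangulation Ω) : ℝ :=
  ⨆ K : T.cells, Metric.diam (hull K.1)

/-- Quasiuniformity with parameter `ρ`: every triangle contains a disc of diameter at least
`ρ h`, where `h` is the largest diameter of all the triangles. -/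
def Triangulation.IsQuasiuniform (T : Triangulation Ω) (ρ : ℝ) : Prop :=
  ∀ K ∈ T.cells, ∃ (c : Plane) (r : ℝ),
    ρ * T.meshSize ≤ 2 * r ∧ Metric.closedBall c r ⊆ hull K

/-- The triangles are aligned with the partitioning: no piece has boundary points in the
interior of a triangle. -/
def Triangulation.IsAligned (T : Triangulation Ω) {n : ℕ} (D : Fin n → Set Plane) : Prop :=
  ∀ K ∈ T.cells, ∀ j, Disjoint (interior (hull K)) (frontier (D j))

open scoped Classical in
/-- The set `E_h` of edges; an edge is given by its two endpoints. -/
def Triangulation.edges (T : Triangulation Ω) : Finset (Finset Plane) :=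
  T.cells.biUnion fun K => K.powersetCard 2

open scoped Classical in
/-- The set `E_h^in` of interior edges: those not contained in `∂Ω`. -/
def Triangulation.interiorEdges (T : Triangulation Ω) : Finset (Finset Plane) :=
  T.edges.filter fun e => ¬ hull e ⊆ frontier Ω

open scoped Classical in
/-- The triangles that have `e` as an edge. -/
def Triangulation.cellsAt (T : Triangulation Ω) (e : Finset Plane) : Finset (Finset Plane) :=
  T.cells.filter fun K => e ⊆ K

/-- The midpoint `m_e` of the edge `e`. -/
def mid (e : Finset Plane) : Plane := (1 / 2 : ℝ) • ∑ p ∈ e, p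

/-! ### The Crouzeix-Raviart space and the finite element form -/

/-- `v` belongs to the Crouzeix-Raviart space `V_h`: on every triangle it is affine in the
interior and, with the same affine function, at the midpoints of the edges (hence it is
continuous at the midpoints); it vanishes at the midpoints of the boundary edges.  The
values at the other points of the edges, a null set, and outside of the closure of `Ω` are
irrelevant. -/
def Triangulation.IsCR (T : Triangulation Ω) (v : Plane → ℝ) : Prop :=
  (∀ K ∈ T.cells, ∃ A : Plane →ᵃ[ℝ] ℝ,
    (∀ x ∈ interior (hull K), v x = A x) ∧ ∀ e ∈ K.powersetCard 2, v (mid e) = A (mid e)) ∧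
  ∀ e ∈ T.edges, hull e ⊆ frontier Ω → v (mid e) = 0

/-- `a_h^{FE}(u,v) = ∑_K ∫_K α ∇u · ∇v dx`. -/
def Triangulation.aFE (T : Triangulation Ω) (α u v : Plane → ℝ) : ℝ :=
  ∑ K ∈ T.cells, ∫ x in hull K, α x * inner ℝ (gradient u x) (gradient v x)

/-- The energy norm `‖u‖_a = a_h^{FE}(u,u)^{1/2}`. -/
def Triangulation.energyNorm (T : Triangulation Ω) (α u : Plane → ℝ) : ℝ :=
  Real.sqrt (T.aFE α u u)

/-! ### Control volumes and the finite volume element form -/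

/-- A choice of one point `z K` in the interior of every triangle `K`. -/
def Triangulation.IsInteriorChoice (T : Triangulation Ω) (z : Finset Plane → Plane) : Prop :=
  ∀ K ∈ T.cells, z K ∈ interior (hull K)

/-- The control volume `b_e`: the union of the subtriangles `conv (e ∪ {z K})` over the
triangles `K` with edge `e`. -/
def Triangulation.controlVolume (T : Triangulation Ω) (z : Finset Plane → Plane)
    (e : Finset Plane) : Set Plane :=
  ⋃ K ∈ T.cellsAt e, convexHull ℝ ((e : Set Plane) ∪ {z K})

/-- `I_h^* v = ∑_e v(m_e) χ_e` over the interior edges, `χ_e` the characteristic function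
of `b_e`. -/
def Triangulation.dualInterp (T : Triangulation Ω) (z : Finset Plane → Plane)
    (v : Plane → ℝ) (x : Plane) : ℝ :=
  ∑ e ∈ T.interiorEdges, v (mid e) * (T.controlVolume z e).indicator (fun _ => 1) x

/-- Rotation by a right angle. -/
def rot (w : Plane) : Plane := !₂[-w 1, w 0]

/-- The unit normal to the side `[p, z]` of the triangle with vertices `p, q, z` that points
out of this triangle, that is, away from `q`. -/
def outerNormal (p q z : Plane) : Plane :=
  if 0 < inner ℝ (rot (z - p)) (q - p) then -(‖z - p‖⁻¹ • rot (z - p))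
  else ‖z - p‖⁻¹ • rot (z - p)

/-- `∫_{[p,z]} α ∇u · n ds`, with `n` the normal pointing out of the triangle `p, q, z`. -/
def sideFlux (α u : Plane → ℝ) (p q z : Plane) : ℝ :=
  ‖z - p‖ * ∫ t in (0 : ℝ)..1, α (AffineMap.lineMap p z t) *
    inner ℝ (gradient u (AffineMap.lineMap p z t)) (outerNormal p q z)

open scoped Classical in
/-- `∫_{∂b_e} α ∇u · n ds` for an interior edge `e`, with `n` the outer unit normal of `b_e`.
The boundary of `b_e` consists of the segments `[p, z K]`, where `p` is one of the two endpoints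
`p, q` of `e` and `K` is one of the two triangles with edge `e`. -/
def Triangulation.boundaryFlux (T : Triangulation Ω) (z : Finset Plane → Plane)
    (α u : Plane → ℝ) (e : Finset Plane) : ℝ :=
  ∑ K ∈ T.cellsAt e, ∑ pq ∈ e.offDiag, sideFlux α u pq.1 pq.2 (z K)

/-- `a_h^{FV}(u,w) = -∑_e w(m_e) ∫_{∂b_e} α ∇u · n ds` over the interior edges. -/
def Triangulation.aFV (T : Triangulation Ω) (z : Finset Plane → Plane)
    (α u w : Plane → ℝ) : ℝ :=
  -∑ e ∈ T.interiorEdges, w (mid e) * T.boundaryFlux z α u e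

end

end CRFVE

namespace CRFVE

/-! The two forms agree triangle by triangle when the coefficient is constant; a variable
coefficient perturbs this by its oscillation on one triangle, which is of order `h`.

On a triangle `K = abc` the gradients `g` of `u` and `d` of `v` are constant. The segment from a
vertex to `z` borders two subtriangles with opposite outer normals, so summation by parts turns the
flux terms of `K` into a sum over vertices. At `a` it contains the mean of `α` on `[a, z]`, times
`⟪g, rot (z - a)⟫`, times the difference `⟪d, b - c⟫ / 2` of two midpoint values of `v`. If all
three means equal `α z`, then `sum_inner_rot_mul_inner` makes this sum `-α z |K| ⟪g, d⟫`, cancelling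
the finite element term, wherever `z` lies.

In general the means along the segments and over `K` differ from `α z` by at most `2 max(L,0) h`:
the interior of `K` is convex and lies in one piece `D j` (`exists_interior_subset`), and
mollification shows that `α` is Lipschitz along segments there (`abs_sub_le_of_isWeakPartial`). This
gives the local bound `abs_integral_add_flux_le`. Quasiuniformity bounds `h ^ 2` by the area, `α ≥
1` bounds the area by the integral of `α`, and Cauchy–Schwarz over the triangles gives the first
estimate. Boundedness and coercivity follow from those of the finite element form. -/

/-! ### Weak derivatives and Lipschitz bounds along segments -/

theorem abs_setIntegral_mul_le {U : Set Plane} {g ψ : Plane → ℝ} {M : ℝ} (hM : 0 ≤ M)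
    (hg : eLpNorm g ⊤ (volume.restrict U) ≤ ENNReal.ofReal M)
    (hψ : Integrable ψ) (hψ0 : ∀ x, 0 ≤ ψ x) :
    |∫ x in U, g x * ψ x| ≤ M * ∫ x, ψ x := by
  have hb : ∀ᵐ x ∂(volume.restrict U), |g x| ≤ M := by
    rw [eLpNorm_exponent_top] at hg
    filter_upwards [ae_le_eLpNormEssSup (f := g) (μ := volume.restrict U)] with x hx
    have h := hx.trans hg
    rw [← ofReal_norm, ENNReal.ofReal_le_ofReal_iff hM] at h
    exact h
  calc |∫ x in U, g x * ψ x| ≤ ∫ x in U, M * ψ x := by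
        rw [← Real.norm_eq_abs]
        refine norm_integral_le_of_norm_le (hψ.restrict.const_mul M) ?_
        filter_upwards [hb] with x hx
        rw [norm_mul, Real.norm_eq_abs, Real.norm_eq_abs, abs_of_nonneg (hψ0 x)]
        exact mul_le_mul_of_nonneg_right hx (hψ0 x)
    _ = M * ∫ x in U, ψ x := integral_const_mul _ _
    _ ≤ M * ∫ x, ψ x := by
        refine mul_le_mul_of_nonneg_left ?_ hM
        exact setIntegral_le_integral hψ (Filter.Eventually.of_forall hψ0)

open scoped Convolution in
/-- Differentiating a mollification of `f` amounts to mollifying the weak derivative. -/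
theorem IsWeakPartial.abs_fderiv_convolution_le {U : Set Plane} (hU : IsOpen U) {f g : Plane → ℝ}
    {i : Fin 2} {M : ℝ} (hM : 0 ≤ M) (hfg : IsWeakPartial U i f g)
    (hg : eLpNorm g ⊤ (volume.restrict U) ≤ ENNReal.ofReal M)
    (φ : ContDiffBump (0 : Plane)) {w : Plane} (hw : Metric.closedBall w φ.rOut ⊆ U)
    (hF : LocallyIntegrable (U.indicator f)) :
    |((fderiv ℝ (φ.normed volume)) ⋆[(ContinuousLinearMap.lsmul ℝ ℝ).precompL Plane, volume]
      (U.indicator f)) w (EuclideanSpace.single i 1)| ≤ M := by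
  set e : Plane := EuclideanSpace.single i 1
  -- The reflected, translated bump is the test function for the weak derivative; the sign from the
  -- reflection cancels the one in `IsWeakPartial`.
  set ψ : Plane → ℝ := fun y => φ.normed volume (w - y) with hψ
  have hφs : ContDiff ℝ ∞ (φ.normed (volume : Measure Plane)) := φ.contDiff_normed
  have hψs : ContDiff ℝ ∞ ψ := hφs.comp (contDiff_const.sub contDiff_id)
  have hψsupp : tsupport ψ ⊆ Metric.closedBall w φ.rOut := by
    refine closure_minimal ?_ Metric.isClosed_closedBall
    intro y hy
    have : w - y ∈ Function.support (φ.normed (volume : Measure Plane)) := hy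
    rw [φ.support_normed_eq, mem_ball_zero_iff] at this
    rw [Metric.mem_closedBall, dist_comm, dist_eq_norm]
    exact this.le
  have hψc : HasCompactSupport ψ :=
    (isCompact_closedBall w φ.rOut).of_isClosed_subset (isClosed_tsupport _) hψsupp
  have hder : ∀ y, fderiv ℝ ψ y e = -fderiv ℝ (φ.normed volume) (w - y) e := by
    intro y
    have h1 : HasFDerivAt (φ.normed (volume : Measure Plane))
        (fderiv ℝ (φ.normed volume) (w - y)) (w - y) :=
      (hφs.differentiable (by simp)).differentiableAt.hasFDerivAt
    have h2 := h1.comp y ((hasFDerivAt_id y).const_sub w)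
    have h3 : fderiv ℝ ψ y = _ := h2.fderiv
    rw [h3]; simp
  have hconv : ((fderiv ℝ (φ.normed volume))
      ⋆[(ContinuousLinearMap.lsmul ℝ ℝ).precompL Plane, volume] (U.indicator f)) w e
      = ∫ x in U, g x * ψ x := by
    have hex := ((φ.hasCompactSupport_normed (μ := (volume : Measure Plane))).fderiv ℝ
      |>.convolutionExists_left ((ContinuousLinearMap.lsmul ℝ ℝ).precompL Plane)
      (hφs.continuous_fderiv (by simp)) hF) w
    rw [convolution_def, ContinuousLinearMap.integral_apply hex]
    have h4 := hfg ψ hψs hψc (hψsupp.trans hw)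
    rw [← neg_eq_iff_eq_neg] at h4
    rw [← h4, ← integral_sub_left_eq_self _ volume w, ← integral_neg, 
      ← integral_indicator hU.measurableSet]
    refine integral_congr_ae (Filter.Eventually.of_forall fun y => ?_)
    by_cases hy : y ∈ U
    · simp [hy, e, hder, ContinuousLinearMap.precompL_apply, mul_comm]
    · simp [hy]
  rw [hconv]
  have hint : Integrable ψ := hψs.continuous.integrable_of_hasCompactSupport hψc
  refine (abs_setIntegral_mul_le hM hg hint fun x => φ.nonneg_normed _).trans ?_
  have : ∫ x, ψ x = 1 := by
    rw [hψ, integral_sub_left_eq_self (φ.normed volume) volume w]; exact φ.integral_normed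
  rw [this, mul_one]

/-- Each coordinate of `w` is bounded by `‖w‖`, which gives the factor `2` instead of the sharp
`√2`. This is the `2` in all later Lipschitz bounds. -/
theorem norm_le_of_apply_single_le {D : Plane →L[ℝ] ℝ} {M : ℝ} (hM : 0 ≤ M)
    (h : ∀ i, |D (EuclideanSpace.single i 1)| ≤ M) : ‖D‖ ≤ 2 * M := by
  refine D.opNorm_le_bound (by positivity) fun w => ?_
  have hw : w = w 0 • EuclideanSpace.single 0 1 + w 1 • EuclideanSpace.single 1 1 := by
    ext i; fin_cases i <;> simp
  have h0 : |w 0| ≤ ‖w‖ := PiLp.norm_apply_le w 0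
  have h1 : |w 1| ≤ ‖w‖ := PiLp.norm_apply_le w 1
  rw [hw, map_add, map_smul, map_smul, ← hw, Real.norm_eq_abs, smul_eq_mul, smul_eq_mul]
  refine (abs_add_le _ _).trans ?_
  rw [abs_mul, abs_mul]
  have a0 := mul_le_mul h0 (h 0) (abs_nonneg _) (norm_nonneg w)
  have a1 := mul_le_mul h1 (h 1) (abs_nonneg _) (norm_nonneg w)
  linarith

/-- A continuous function with weak partial derivatives bounded by `M` is Lipschitz along
segments. -/
theorem abs_sub_le_of_isWeakPartial {U : Set Plane} (hU : IsOpen U) {f : Plane → ℝ}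
    {g : Fin 2 → Plane → ℝ} {M : ℝ} (hM : 0 ≤ M) (hf : ContinuousOn f U)
    (hfb : MemLp f ⊤ (volume.restrict U)) (hfg : ∀ i, IsWeakPartial U i f (g i))
    (hg : ∀ i, eLpNorm (g i) ⊤ (volume.restrict U) ≤ ENNReal.ofReal M)
    {x y : Plane} (hxy : segment ℝ x y ⊆ U) : |f y - f x| ≤ 2 * M * ‖y - x‖ := by
  have hx : x ∈ U := hxy (left_mem_segment ℝ x y)
  have hy : y ∈ U := hxy (right_mem_segment ℝ x y)
  have hFm : MemLp (U.indicator f) ⊤ volume := (memLp_indicator_iff_restrict hU.measurableSet).2 hfb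
  have hF : LocallyIntegrable (U.indicator f) := hFm.locallyIntegrable le_top
  have hcpt : IsCompact (segment ℝ x y) := by
    rw [← convexHull_pair]; exact (Set.toFinite {x, y}).isCompact_convexHull (𝕜 := ℝ)
  obtain ⟨δ, hδ, hδU⟩ := hcpt.exists_cthickening_subset_open hU hxy
  -- Mollifications of radius at most `δ` see only values of `f` in `U` near the segment, so the
  -- mean value inequality applies to them with a constant independent of the radius.
  have key : ∀ φ : ContDiffBump (0 : Plane), φ.rOut ≤ δ →
      |(convolution (φ.normed volume) (U.indicator f) (ContinuousLinearMap.lsmul ℝ ℝ) volume) y -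
        (convolution (φ.normed volume) (U.indicator f) (ContinuousLinearMap.lsmul ℝ ℝ) volume) x|
        ≤ 2 * M * ‖y - x‖ := by
    intro φ hφ
    rw [← Real.norm_eq_abs]
    refine (convex_segment x y).norm_image_sub_le_of_norm_hasFDerivWithin_le (fun w _ =>
      (φ.hasCompactSupport_normed.hasFDerivAt_convolution_left (ContinuousLinearMap.lsmul ℝ ℝ)
        φ.contDiff_normed hF w).hasFDerivWithinAt) (fun w hw => ?_)
      (left_mem_segment ℝ x y) (right_mem_segment ℝ x y)
    refine norm_le_of_apply_single_le hM fun i =>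
      (hfg i).abs_fderiv_convolution_le hU hM (hg i) φ ?_ hF
    exact (Metric.closedBall_subset_closedBall hφ).trans
      ((Metric.closedBall_subset_cthickening hw δ).trans hδU)
  -- Continuity of `f` gives convergence of the mollifications at each point, not merely almost
  -- everywhere.
  have near : ∀ w ∈ U, ∀ η > 0, ∃ ε > 0, ∀ φ : ContDiffBump (0 : Plane), φ.rOut ≤ ε →
      |(convolution (φ.normed volume) (U.indicator f) (ContinuousLinearMap.lsmul ℝ ℝ) volume) w
        - f w| ≤ η := by
    intro w hw η hη
    have hc : ContinuousAt f w := hf.continuousAt (hU.mem_nhds hw)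
    obtain ⟨ε₁, hε₁, h₁⟩ := Metric.continuousAt_iff.1 hc η hη
    obtain ⟨ε₂, hε₂, h₂⟩ := Metric.isOpen_iff.1 hU w hw
    refine ⟨min ε₁ ε₂, lt_min hε₁ hε₂, fun φ hφ => ?_⟩
    have := φ.dist_normed_convolution_le (μ := volume) (g := U.indicator f) (x₀ := w) (ε := η)
      hFm.1 (fun v hv => ?_)
    · rwa [Set.indicator_of_mem hw, Real.dist_eq] at this
    · have hv' : dist v w < min ε₁ ε₂ := (Metric.mem_ball.1 hv).trans_le hφ
      rw [Set.indicator_of_mem hw, Set.indicator_of_mem (h₂ (hv'.trans_le (min_le_right _ _)))]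
      exact (h₁ (hv'.trans_le (min_le_left _ _))).le
  refine le_of_forall_pos_le_add fun η hη => ?_
  obtain ⟨ε₁, hε₁, h₁⟩ := near x hx (η / 2) (by positivity)
  obtain ⟨ε₂, hε₂, h₂⟩ := near y hy (η / 2) (by positivity)
  have hr : 0 < min δ (min ε₁ ε₂) := lt_min hδ (lt_min hε₁ hε₂)
  let φ : ContDiffBump (0 : Plane) :=
    ⟨min δ (min ε₁ ε₂) / 2, min δ (min ε₁ ε₂), by positivity, by linarith⟩
  have b1 := abs_le.1 (h₁ φ ((min_le_right _ _).trans (min_le_left _ _)))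
  have b2 := abs_le.1 (h₂ φ ((min_le_right _ _).trans (min_le_right _ _)))
  have b3 := abs_le.1 (key φ (min_le_left _ _))
  rw [abs_le]
  constructor <;> linarith [b1.1, b1.2, b2.1, b2.2, b3.1, b3.2]

/-! ### Signed areas, triangles and edge midpoints -/

/-- Twice the signed area of the triangle `p, q, r`. -/
noncomputable def cross (p q r : Plane) : ℝ := inner ℝ (rot (q - p)) (r - p)

theorem cross_eq (p q r : Plane) :
    cross p q r = (q 0 - p 0) * (r 1 - p 1) - (q 1 - p 1) * (r 0 - p 0) := by
  simp [cross, rot, PiLp.inner_apply, Fin.sum_univ_two]; ring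

theorem cross_rotate (p q r : Plane) : cross q r p = cross p q r := by
  simp only [cross_eq]; ring

theorem cross_swap (p q r : Plane) : cross q p r = -cross p q r := by
  simp only [cross_eq]; ring

theorem cross_add_smul_add_smul (p q a b c : Plane) (s t : ℝ) :
    cross p q (a + s • (b - a) + t • (c - a)) =
      (1 - s - t) * cross p q a + s * cross p q b + t * cross p q c := by
  simp only [cross_eq, PiLp.add_apply, PiLp.smul_apply, PiLp.sub_apply, smul_eq_mul]; ring

/-- The triangle with the vertices `0`, `(1, 0)`, `(0, 1)`. -/
def refTriangle : Set Plane := {x | 0 ≤ x 0 ∧ 0 ≤ x 1 ∧ x 0 + x 1 ≤ 1}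

theorem mem_convexHull_triple {a b c x : Plane} : x ∈ convexHull ℝ ({a, b, c} : Set Plane) ↔
    ∃ s t : ℝ, 0 ≤ s ∧ 0 ≤ t ∧ s + t ≤ 1 ∧ x = a + s • (b - a) + t • (c - a) := by
  constructor
  · intro hx
    let S : Set Plane :=
      {x | ∃ s t : ℝ, 0 ≤ s ∧ 0 ≤ t ∧ s + t ≤ 1 ∧ x = a + s • (b - a) + t • (c - a)}
    have hS : Convex ℝ S := by
      rintro _ ⟨s, t, hs, ht, hst, rfl⟩ _ ⟨s', t', hs', ht', hst', rfl⟩ l m hl hm hlm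
      refine ⟨l * s + m * s', l * t + m * t', by positivity, by positivity, ?_, ?_⟩
      · nlinarith
      · have : l = 1 - m := by linarith
        subst this; module
    have hsub : ({a, b, c} : Set Plane) ⊆ S := by
      rintro y (rfl | rfl | rfl)
      · exact ⟨0, 0, by simp⟩
      · exact ⟨1, 0, by simp⟩
      · exact ⟨0, 1, by simp⟩
    exact convexHull_min hsub hS hx
  · rintro ⟨s, t, hs, ht, hst, rfl⟩
    have h := (convex_convexHull ℝ ({a, b, c} : Set Plane)).sum_mem (t := Finset.univ)
      (w := ![1 - s - t, s, t]) (z := ![a, b, c])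
      (by intro i _; fin_cases i <;> simp <;> linarith) (by simp [Fin.sum_univ_three]; ring)
      (by intro i _; fin_cases i <;> exact subset_convexHull ℝ _ (by simp))
    simp only [Fin.sum_univ_three, Matrix.cons_val] at h
    convert h using 1
    module

theorem volume_refTriangle : volume refTriangle = ENNReal.ofReal (1 / 2) := by
  have h1 : refTriangle = (WithLp.ofLp : Plane → Fin 2 → ℝ) ⁻¹' (MeasurableEquiv.finTwoArrow ⁻¹'
      {x : ℝ × ℝ | 0 ≤ x.1 ∧ 0 ≤ x.2 ∧ x.1 + x.2 ≤ 1}) := by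
    ext x; simp [refTriangle, MeasurableEquiv.finTwoArrow]
  have hm : MeasurableSet {x : ℝ × ℝ | 0 ≤ x.1 ∧ 0 ≤ x.2 ∧ x.1 + x.2 ≤ 1} := by
    apply IsClosed.measurableSet
    exact (isClosed_le continuous_const continuous_fst).inter
      ((isClosed_le continuous_const continuous_snd).inter
        (isClosed_le (continuous_fst.add continuous_snd) continuous_const))
  rw [h1, (PiLp.volume_preserving_ofLp (Fin 2)).measure_preimage
    ((MeasurableEquiv.measurable _ hm).nullMeasurableSet),
    (volume_preserving_finTwoArrow ℝ).measure_preimage hm.nullMeasurableSet, Measure.volume_eq_prod,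
    Measure.prod_apply hm]
  have h2 : ∀ x : ℝ, volume (Prod.mk x ⁻¹' {x : ℝ × ℝ | 0 ≤ x.1 ∧ 0 ≤ x.2 ∧ x.1 + x.2 ≤ 1}) =
      (Set.Icc (0 : ℝ) 1).indicator (fun x => ENNReal.ofReal (1 - x)) x := by
    intro x
    by_cases hx : 0 ≤ x
    · have : Prod.mk x ⁻¹' {x : ℝ × ℝ | 0 ≤ x.1 ∧ 0 ≤ x.2 ∧ x.1 + x.2 ≤ 1} = Set.Icc 0 (1 - x) := by
        ext y; simp [hx, le_sub_iff_add_le']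
      rw [this, Real.volume_Icc, sub_zero]
      by_cases h : x ≤ 1
      · simp [hx, h]
      · rw [Set.indicator_of_notMem (fun h' => h h'.2)]
        exact ENNReal.ofReal_of_nonpos (by linarith)
    · rw [Set.indicator_of_notMem (fun h' => hx h'.1)]
      have : Prod.mk x ⁻¹' {x : ℝ × ℝ | 0 ≤ x.1 ∧ 0 ≤ x.2 ∧ x.1 + x.2 ≤ 1} = ∅ := by
        ext y; simp [hx]
      simp [this]
  simp_rw [h2]
  rw [lintegral_indicator measurableSet_Icc, ← ofReal_integral_eq_lintegral_ofReal,
    integral_Icc_eq_integral_Ioc, ← intervalIntegral.integral_of_le zero_le_one]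
  · rw [intervalIntegral.integral_sub (by simp) (by simp)]; norm_num
  · exact (continuous_const.sub continuous_id).integrableOn_Icc
  · filter_upwards [ae_restrict_mem measurableSet_Icc] with x hx
    simpa using hx.2

/-- The triangle is an affine image of `refTriangle`, and the linear part has determinant `cross a b
c`. -/
theorem volume_convexHull_triple (a b c : Plane) :
    volume (convexHull ℝ ({a, b, c} : Set Plane)) = ENNReal.ofReal (|cross a b c| / 2) := by
  let e := (EuclideanSpace.basisFun (Fin 2) ℝ).toBasis
  let f : Plane →ₗ[ℝ] Plane :=
    Matrix.toLin e e !![b 0 - a 0, c 0 - a 0; b 1 - a 1, c 1 - a 1]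
  have hf : ∀ x, f x = x 0 • (b - a) + x 1 • (c - a) := by
    intro x
    ext i
    fin_cases i <;>
    simp [f, e, Matrix.toLin_apply, Matrix.mulVec, dotProduct, Fin.sum_univ_two] <;> ring
  have hdet : LinearMap.det f = cross a b c := by
    simp only [f, LinearMap.det_toLin, Matrix.det_fin_two_of, cross_eq]; ring
  have himg : convexHull ℝ ({a, b, c} : Set Plane) = (fun x => a + x) '' (f '' refTriangle) := by
    ext x
    rw [mem_convexHull_triple, Set.image_image]
    constructor
    · rintro ⟨s, t, hs, ht, hst, rfl⟩
      exact ⟨!₂[s, t], ⟨by simpa, by simpa, by simpa⟩, by simp [hf, add_assoc]⟩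
    · rintro ⟨y, ⟨h0, h1, h2⟩, rfl⟩
      exact ⟨y 0, y 1, h0, h1, h2, by simp [hf, add_assoc]⟩
  rw [himg, Set.image_add_left, measure_preimage_add, Measure.addHaar_image_linearMap, hdet,
    volume_refTriangle, ← ENNReal.ofReal_mul (abs_nonneg _)]
  congr 1; ring

/-- Interior points of a triangle lie strictly on the inner side of every edge. -/
theorem cross_pos_of_mem_interior {a b c z : Plane} (h : 0 < cross a b c)
    (hz : z ∈ interior (convexHull ℝ ({a, b, c} : Set Plane))) : 0 < cross a b z := by
  have hnn : ∀ x ∈ convexHull ℝ ({a, b, c} : Set Plane), 0 ≤ cross a b x := by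
    intro x hx
    obtain ⟨s, t, hs, ht, hst, rfl⟩ := mem_convexHull_triple.1 hx
    rw [cross_add_smul_add_smul]
    have : cross a b a = 0 := by rw [cross_eq]; ring
    have h' : cross a b b = 0 := by rw [cross_eq]; ring
    rw [this, h']
    simpa using mul_nonneg ht h.le
  -- A small move from `z` along `-rot (b - a)` stays in the triangle, where `cross a b` is
  -- nonnegative, and strictly decreases `cross a b`. Hence it was positive at `z`.
  have hcont : Filter.Tendsto (fun ε : ℝ => z - ε • rot (b - a)) (nhds 0) (nhds z) := by
    have : Continuous (fun ε : ℝ => z - ε • rot (b - a)) := by fun_prop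
    simpa using this.tendsto 0
  obtain ⟨δ, hδ, hball⟩ := Metric.eventually_nhds_iff.1
    (hcont.eventually (mem_interior_iff_mem_nhds.1 hz))
  have h1 := hnn _ (hball (y := δ / 2) (by simp [abs_of_pos hδ]; linarith))
  have h2 : cross a b (z - (δ / 2) • rot (b - a)) = cross a b z -
      (δ / 2) * ((b 0 - a 0) ^ 2 + (b 1 - a 1) ^ 2) := by
    simp [cross_eq, rot]; ring
  have h3 : 0 < (b 0 - a 0) ^ 2 + (b 1 - a 1) ^ 2 := by
    by_contra hcon
    have h0 : b 0 - a 0 = 0 := by nlinarith [sq_nonneg (b 0 - a 0), sq_nonneg (b 1 - a 1)]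
    have h0' : b 1 - a 1 = 0 := by nlinarith [sq_nonneg (b 0 - a 0), sq_nonneg (b 1 - a 1)]
    rw [cross_eq, h0, h0'] at h
    simp at h
  rw [h2] at h1
  nlinarith [mul_pos hδ h3]

theorem cross_ne_zero {K : Finset Plane} (hK : AffineIndependent ℝ ((↑) : K → Plane))
    {a b c : Plane} (ha : a ∈ K) (hb : b ∈ K) (hc : c ∈ K) (hab : a ≠ b) (hac : a ≠ c)
    (hbc : b ≠ c) : cross a b c ≠ 0 := by
  intro h0
  rw [affineIndependent_iff_linearIndependent_vsub ℝ _ (⟨a, ha⟩ : K)] at hK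
  let b' : {x : K // x ≠ ⟨a, ha⟩} := ⟨⟨b, hb⟩, by simpa using hab.symm⟩
  let c' : {x : K // x ≠ ⟨a, ha⟩} := ⟨⟨c, hc⟩, by simpa using hac.symm⟩
  have hne : b' ≠ c' := by simpa [b', c'] using hbc
  have hinj : Function.Injective ![b', c'] := by
    intro i j hij
    fin_cases i <;> fin_cases j <;> simp_all [eq_comm]
  have hli := hK.comp _ hinj
  have hfun : (fun i : {x : K // x ≠ ⟨a, ha⟩} => ((i : K) : Plane) -ᵥ ((⟨a, ha⟩ : K) : Plane)) ∘
      ![b', c'] = ![b - a, c - a] := by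
    ext i : 1
    fin_cases i <;> simp [b', c']
  rw [hfun] at hli
  have hpair := LinearIndependent.pair_iff.1 hli
  rw [cross_eq] at h0
  -- If the determinant vanishes, the coordinates of `b - a` and `c - a` are themselves coefficients
  -- of a linear relation, so independence forces `c = a`.
  obtain ⟨h1, h2⟩ := hpair (c 0 - a 0) (-(b 0 - a 0)) (by
    ext i; fin_cases i <;> simp <;> linarith)
  obtain ⟨h3, h4⟩ := hpair (c 1 - a 1) (-(b 1 - a 1)) (by
    ext i; fin_cases i <;> simp <;> linarith)
  refine hac (PiLp.ext fun i => ?_)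
  fin_cases i <;> simp <;> linarith

theorem exists_cross_pos {K : Finset Plane} (hcard : K.card = 3)
    (hK : AffineIndependent ℝ ((↑) : K → Plane)) :
    ∃ a b c, (∀ x, x ∈ K ↔ x = a ∨ x = b ∨ x = c) ∧ 0 < cross a b c := by
  classical
  obtain ⟨a, b, c, hab, hac, hbc, rfl⟩ := Finset.card_eq_three.1 hcard
  rcases lt_or_gt_of_ne (cross_ne_zero hK (a := a) (b := b) (c := c)
    (by simp) (by simp) (by simp) hab hac hbc) with h | h
  · refine ⟨b, a, c, fun x => by simp; tauto, ?_⟩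
    rw [cross_swap]; linarith
  · exact ⟨a, b, c, fun x => by simp, h⟩

theorem ne_of_cross_pos {a b c : Plane} (h : 0 < cross a b c) : a ≠ b ∧ b ≠ c ∧ c ≠ a := by
  refine ⟨?_, ?_, ?_⟩ <;> rintro rfl <;> rw [cross_eq] at h <;> nlinarith

theorem mid_eq_of_mem_iff {p q : Plane} (hpq : p ≠ q) (e : Finset Plane) (he : ∀ x, x ∈ e ↔ x = p ∨ x = q) :
    mid e = (1 / 2 : ℝ) • (p + q) := by
  classical
  have : e = {p, q} := by ext x; simp [he]
  rw [mid, this, Finset.sum_pair hpq]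

/-- The midpoint of an edge belongs only to triangles having that edge. -/
theorem edge_subset_of_mid_mem {s : Set Plane} {K e : Finset Plane} (hcard : K.card = 3)
    (hK : AffineIndependent ℝ ((↑) : K → Plane)) (heK : e ∈ K.powersetCard 2)
    (hm : mid e ∈ convexHull ℝ ((K : Set Plane) ∩ s)) : (e : Set Plane) ⊆ s := by
  classical
  intro p hp
  by_contra hps
  obtain ⟨hsub, he⟩ := Finset.mem_powersetCard.1 heK
  have hpe : p ∈ e := hp
  obtain ⟨q, hq⟩ : ∃ q, e.erase p = {q} := Finset.card_eq_one.1 (by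
    rw [Finset.card_erase_of_mem hpe, he])
  have hqe : q ∈ e.erase p := by simp [hq]
  have hqp : q ≠ p := (Finset.mem_erase.1 hqe).1
  obtain ⟨r, hr⟩ : ∃ r, K \ e = {r} := Finset.card_eq_one.1 (by
    rw [Finset.card_sdiff_of_subset hsub, hcard, he])
  have hrK : r ∈ K \ e := by simp [hr]
  obtain ⟨hrK, hre⟩ := Finset.mem_sdiff.1 hrK
  have he_mem : ∀ x, x ∈ e ↔ x = p ∨ x = q := by
    intro x
    rw [← Finset.insert_erase hpe, hq]; simp
  have hrp : r ≠ p := fun h => hre (h ▸ hpe)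
  have hrq : r ≠ q := fun h => hre ((he_mem r).2 (Or.inr h))
  -- Without `p`, the vertices of `K` in `s` lie on the line `qr`, whereas the midpoint of `pq` does
  -- not.
  have hconv : Convex ℝ {x | cross q r x = 0} := by
    intro x hx y hy l m _ _ hlm
    simp only [Set.mem_ofPred_eq] at hx hy ⊢
    have : cross q r (l • x + m • y) = l * cross q r x + m * cross q r y := by
      have : l = 1 - m := by linarith
      subst this
      simp only [cross_eq, PiLp.add_apply, PiLp.smul_apply, smul_eq_mul]; ring
    rw [this, hx, hy]; ring
  have hin : (K : Set Plane) ∩ s ⊆ {x | cross q r x = 0} := by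
    rintro x ⟨hxK, hxs⟩
    have hx : x = q ∨ x = r := by
      by_cases hxe : x ∈ e
      · rcases (he_mem x).1 hxe with rfl | h
        · exact absurd hxs hps
        · exact Or.inl h
      · have : x ∈ K \ e := Finset.mem_sdiff.2 ⟨hxK, hxe⟩
        rw [hr] at this
        exact Or.inr (Finset.mem_singleton.1 this)
    rcases hx with rfl | rfl <;> simp only [Set.mem_ofPred_eq, cross_eq] <;> ring
  have h0 := convexHull_min hin hconv hm
  rw [Set.mem_ofPred_eq, mid_eq_of_mem_iff hqp.symm e he_mem] at h0
  have h1 : cross q r ((1 / 2 : ℝ) • (p + q)) = cross q r p / 2 := by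
    simp only [cross_eq, PiLp.add_apply, PiLp.smul_apply, smul_eq_mul]; ring
  rw [h1] at h0
  exact cross_ne_zero hK (hsub (Finset.mem_erase.1 hqe).2) hrK (hsub hpe) hrq.symm hqp hrp
    (by linarith)

theorem hull_eq_triple {K : Finset Plane} {a b c : Plane}
    (hK : ∀ x, x ∈ K ↔ x = a ∨ x = b ∨ x = c) : hull K = convexHull ℝ {a, b, c} := by
  rw [hull]; congr 1; ext x; simp [hK]

/-- Both `c` and `z` lie strictly on the inner side of `ab`, so the subtriangle `p, c, z` meets the
line `ab` only at the endpoint `p`, which is not the midpoint. -/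
theorem mid_notMem_of_ne {a b c z : Plane} (h : 0 < cross a b c)
    (hz : z ∈ interior (convexHull ℝ ({a, b, c} : Set Plane))) {p : Plane} (hp : p = a ∨ p = b) :
    (1 / 2 : ℝ) • (a + b) ∉ convexHull ℝ ({p, c, z} : Set Plane) := by
  intro hm
  have hzpos := cross_pos_of_mem_interior h hz
  obtain ⟨s, t, hs, ht, hst, heq⟩ := mem_convexHull_triple.1 hm
  have h1 := congrArg (cross a b) heq
  have hpz : cross a b p = 0 := by
    rcases hp with rfl | rfl <;> rw [cross_eq] <;> ring
  have hmz : cross a b ((1 / 2 : ℝ) • (a + b)) = 0 := by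
    simp only [cross_eq, PiLp.add_apply, PiLp.smul_apply, smul_eq_mul]; ring
  rw [cross_add_smul_add_smul, hpz, hmz] at h1
  have hs0 : s = 0 := by
    have := mul_nonneg hs h.le; have := mul_nonneg ht hzpos.le
    have : s * cross a b c = 0 := by linarith
    exact (mul_eq_zero.1 this).resolve_right h.ne'
  have ht0 : t = 0 := by
    rw [hs0] at h1
    have : t * cross a b z = 0 := by linarith
    exact (mul_eq_zero.1 this).resolve_right hzpos.ne'
  rw [hs0, ht0, zero_smul, zero_smul, add_zero, add_zero] at heq
  have hab := (ne_of_cross_pos h).1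
  apply hab
  rcases hp with rfl | rfl
  · have : (1 / 2 : ℝ) • (b - p) = 0 := by
      have := sub_eq_zero.2 heq; rw [← this]; module
    exact (sub_eq_zero.1 ((smul_eq_zero.1 this).resolve_left (by norm_num))).symm
  · have : (1 / 2 : ℝ) • (a - p) = 0 := by
      have := sub_eq_zero.2 heq; rw [← this]; module
    exact sub_eq_zero.1 ((smul_eq_zero.1 this).resolve_left (by norm_num))

/-! ### Fluxes and coefficient means along segments -/

theorem norm_rot (w : Plane) : ‖rot w‖ = ‖w‖ := by
  rw [EuclideanSpace.norm_eq, EuclideanSpace.norm_eq]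
  simp [rot, Fin.sum_univ_two, add_comm]

/-- For a counterclockwise triangle `p, q, z`, the vector `rot (z - p)` points away from `q`. The
length factor of `sideFlux` absorbs the normalization. -/
theorem norm_smul_outerNormal_of_pos {p q z : Plane} (h : 0 < cross p q z) :
    ‖z - p‖ • outerNormal p q z = rot (z - p) := by
  have h1 : ¬ 0 < inner ℝ (rot (z - p)) (q - p) := by
    have : inner ℝ (rot (z - p)) (q - p) = -cross p q z := by
      change cross p z q = _; simp only [cross_eq]; ring
    rw [this]; linarith
  have h2 : ‖z - p‖ ≠ 0 := norm_ne_zero_iff.2 (sub_ne_zero.2 (ne_of_cross_pos h).2.2)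
  rw [outerNormal, if_neg h1, smul_inv_smul₀ h2]

theorem norm_smul_outerNormal_of_neg {p q z : Plane} (h : 0 < cross q p z) :
    ‖z - p‖ • outerNormal p q z = -rot (z - p) := by
  have h1 : 0 < inner ℝ (rot (z - p)) (q - p) := by
    have : inner ℝ (rot (z - p)) (q - p) = cross q p z := by
      change cross p z q = _; simp only [cross_eq]; ring
    rwa [this]
  have h2 : ‖z - p‖ ≠ 0 := norm_ne_zero_iff.2 (sub_ne_zero.2 (ne_of_cross_pos h).2.1.symm)
  rw [outerNormal, if_pos h1, smul_neg, smul_inv_smul₀ h2]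

/-- The mean of `α` along the segment from `p` to `z`. -/
noncomputable def segmentMean (α : Plane → ℝ) (p z : Plane) : ℝ :=
  ∫ t in (0 : ℝ)..1, α (AffineMap.lineMap p z t)

theorem lineMap_mem_interior {s : Set Plane} (hs : Convex ℝ s) {p z : Plane} (hp : p ∈ s)
    (hz : z ∈ interior s) {t : ℝ} (ht : t ∈ Set.Ioc (0 : ℝ) 1) :
    AffineMap.lineMap p z t ∈ interior s := by
  rw [AffineMap.lineMap_apply_module']
  rw [add_comm]
  exact hs.add_smul_sub_mem_interior hp hz ht

theorem sideFlux_eq {s : Set Plane} (hs : Convex ℝ s) {α u : Plane → ℝ} {g p q z : Plane}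
    (hp : p ∈ s) (hz : z ∈ interior s) (hu : ∀ x ∈ interior s, gradient u x = g) :
    sideFlux α u p q z = segmentMean α p z * inner ℝ g (‖z - p‖ • outerNormal p q z) := by
  have : ∫ t in (0 : ℝ)..1, α (AffineMap.lineMap p z t) *
      inner ℝ (gradient u (AffineMap.lineMap p z t)) (outerNormal p q z) =
      ∫ t in (0 : ℝ)..1, α (AffineMap.lineMap p z t) * inner ℝ g (outerNormal p q z) := by
    refine intervalIntegral.integral_congr_ae (Filter.Eventually.of_forall fun t ht => ?_)
    rw [Set.uIoc_of_le zero_le_one] at ht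
    rw [hu _ (lineMap_mem_interior hs hp hz ht)]
  rw [sideFlux, this, intervalIntegral.integral_mul_const, inner_smul_right, segmentMean]
  ring

/-- The endpoint `p` may lie on the boundary, where `α` is not controlled. The integral sees only `t
∈ Ioc 0 1`, and these points are interior. -/
theorem abs_segmentMean_sub_le {s : Set Plane} (hs : Convex ℝ s) {α : Plane → ℝ} {η : ℝ}
    {p z : Plane} (hp : p ∈ s) (hz : z ∈ interior s) (hα : ContinuousOn α (interior s))
    (hosc : ∀ x ∈ interior s, |α x - α z| ≤ η) : |segmentMean α p z - α z| ≤ η := by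
  have hbd : ∀ t ∈ Set.Ioc (0 : ℝ) 1, |α (AffineMap.lineMap p z t) - α z| ≤ η := fun t ht =>
    hosc _ (lineMap_mem_interior hs hp hz ht)
  have hc : ContinuousOn (fun t : ℝ => α (AffineMap.lineMap p z t)) (Set.Ioc (0 : ℝ) 1) :=
    hα.comp (AffineMap.lineMap_continuous.continuousOn)
      fun t ht => lineMap_mem_interior hs hp hz ht
  have hint : IntervalIntegrable (fun t : ℝ => α (AffineMap.lineMap p z t)) volume 0 1 := by
    rw [intervalIntegrable_iff_integrableOn_Ioc_of_le zero_le_one]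
    refine IntegrableOn.of_bound (C := |α z| + η) (by simp)
      (hc.aestronglyMeasurable measurableSet_Ioc) ?_
    filter_upwards [ae_restrict_mem measurableSet_Ioc] with t ht
    have := abs_sub_abs_le_abs_sub (α (AffineMap.lineMap p z t)) (α z)
    rw [Real.norm_eq_abs]
    linarith [hbd t ht]
  have h1 : segmentMean α p z - α z = ∫ t in (0 : ℝ)..1, (α (AffineMap.lineMap p z t) - α z) := by
    rw [intervalIntegral.integral_sub hint (by simp)]; simp [segmentMean]
  rw [h1, ← Real.norm_eq_abs]
  have := intervalIntegral.norm_integral_le_of_norm_le_const (a := (0 : ℝ)) (b := 1) (C := η)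
    (f := fun t => α (AffineMap.lineMap p z t) - α z) (fun t ht => by
      rw [Set.uIoc_of_le zero_le_one] at ht
      exact hbd t ht)
  simpa using this

theorem abs_setIntegral_sub_le {s : Set Plane} {α : Plane → ℝ} {η κ : ℝ}
    (hfin : volume s ≠ ⊤) (hint : IntegrableOn α s)
    (hosc : ∀ᵐ x ∂(volume.restrict s), |α x - κ| ≤ η) :
    |(∫ x in s, α x) - κ * (volume s).toReal| ≤ η * (volume s).toReal := by
  have hκ : IntegrableOn (fun _ : Plane => κ) s := integrableOn_const hfin
  have h1 : (∫ x in s, α x) - κ * (volume s).toReal = ∫ x in s, (α x - κ) := by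
    rw [integral_sub hint hκ, setIntegral_const, smul_eq_mul, mul_comm κ]; rfl
  have hη : IntegrableOn (fun _ : Plane => η) s := integrableOn_const hfin
  rw [h1, ← Real.norm_eq_abs]
  refine (norm_integral_le_of_norm_le hη hosc).trans_eq ?_
  rw [setIntegral_const, smul_eq_mul, mul_comm]; rfl

/-! ### Comparison of the two forms on one triangle -/

theorem sum_powersetCard_two {K : Finset Plane} {a b c : Plane}
    (hK : ∀ x, x ∈ K ↔ x = a ∨ x = b ∨ x = c) (h : 0 < cross a b c) (F : Finset Plane → ℝ) :
    open scoped Classical in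
    ∑ e ∈ K.powersetCard 2, F e = F {a, b} + F {b, c} + F {c, a} := by
  classical
  obtain ⟨hab, hbc, hca⟩ := ne_of_cross_pos h
  have hKe : K = {a, b, c} := by ext x; simp [hK]
  have hcard : K.card = 3 := Finset.card_eq_three.2 ⟨a, b, c, hab, hca.symm, hbc, hKe⟩
  have h1 : ({a, b} : Finset Plane) ≠ {b, c} := fun h' => by
    have : a ∈ ({b, c} : Finset Plane) := h' ▸ (by simp)
    simp [hab, hca.symm] at this
  have h2 : ({a, b} : Finset Plane) ≠ {c, a} := fun h' => by
    have : b ∈ ({c, a} : Finset Plane) := h' ▸ (by simp)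
    simp [hbc, hab.symm] at this
  have h3 : ({b, c} : Finset Plane) ≠ {c, a} := fun h' => by
    have : b ∈ ({c, a} : Finset Plane) := h' ▸ (by simp)
    simp [hbc, hab.symm] at this
  have hp : K.powersetCard 2 = {{a, b}, {b, c}, {c, a}} := by
    symm
    apply Finset.eq_of_subset_of_card_le
    · intro e he
      simp only [Finset.mem_insert, Finset.mem_singleton] at he
      rw [Finset.mem_powersetCard]
      rcases he with rfl | rfl | rfl
      · exact ⟨by simp [hKe, Finset.insert_subset_iff], Finset.card_pair hab⟩
      · exact ⟨by simp [hKe], Finset.card_pair hbc⟩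
      · exact ⟨by simp [hKe, Finset.insert_subset_iff], Finset.card_pair hca⟩
    · rw [Finset.card_powersetCard, hcard,
        Finset.card_eq_three.2 ⟨_, _, _, h1, h2, h3, rfl⟩]
      decide
  rw [hp, Finset.sum_insert (by simp [h1, h2]), Finset.sum_pair h3, add_assoc]

theorem sum_offDiag_pair {a b : Plane} (hab : a ≠ b) (F : Plane × Plane → ℝ) :
    open scoped Classical in
    ∑ pq ∈ ({a, b} : Finset Plane).offDiag, F pq = F (a, b) + F (b, a) := by
  classical
  have : ({a, b} : Finset Plane).offDiag = {(a, b), (b, a)} := by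
    ext ⟨x, y⟩
    simp only [Finset.mem_offDiag, Finset.mem_insert, Finset.mem_singleton, Prod.mk.injEq]
    constructor
    · rintro ⟨rfl | rfl, rfl | rfl, h⟩ <;> simp_all
    · rintro (⟨rfl, rfl⟩ | ⟨rfl, rfl⟩) <;> simp [hab, hab.symm]
  rw [this, Finset.sum_pair (by simp [hab])]

/-- For a constant coefficient the finite element form and the finite volume form coincide on
every triangle. -/
theorem sum_inner_rot_mul_inner (a b c z g d : Plane) :
    inner ℝ g (rot (z - a)) * inner ℝ d (b - c) + inner ℝ g (rot (z - b)) * inner ℝ d (c - a) +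
      inner ℝ g (rot (z - c)) * inner ℝ d (a - b) = -(cross a b c * inner ℝ g d) := by
  simp only [cross_eq, rot, PiLp.inner_apply, Fin.sum_univ_two, PiLp.sub_apply]
  simp
  ring

open scoped Classical in
-- Replacing the integral and the three segment means by their values for the constant coefficient
-- `α z` leaves zero. The replacement costs `η |K|` for the integral and, for each vertex, `η h ^ 2
-- / 2`: one factor `h` from the length of the segment, one from the side opposite to the vertex,
-- and `1 / 2` from the midpoint values.
theorem abs_integral_add_flux_le {K : Finset Plane} (hcard : K.card = 3)
    (hK : AffineIndependent ℝ ((↑) : K → Plane)) {z : Plane} (hz : z ∈ interior (hull K))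
    {α u v : Plane → ℝ} {η h : ℝ} (hα : ContinuousOn α (interior (hull K)))
    (hint : IntegrableOn α (hull K)) (hosc : ∀ x ∈ interior (hull K), |α x - α z| ≤ η)
    (hdiam : Metric.diam (hull K) ≤ h) {g d : Plane} {k : ℝ}
    (hu : ∀ x ∈ interior (hull K), gradient u x = g)
    (hv : ∀ e ∈ K.powersetCard 2, v (mid e) = inner ℝ d (mid e) + k) :
    |(∫ x in hull K, α x) * inner ℝ g d +
        ∑ e ∈ K.powersetCard 2, v (mid e) * ∑ pq ∈ e.offDiag, sideFlux α u pq.1 pq.2 z| ≤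
      η * ((volume (hull K)).toReal + 3 / 2 * h ^ 2) * (‖g‖ * ‖d‖) := by
  obtain ⟨a, b, c, hmem, hpos⟩ := exists_cross_pos hcard hK
  obtain ⟨hab, hbc, hca⟩ := ne_of_cross_pos hpos
  have hH := hull_eq_triple hmem
  have hvol : (volume (hull K)).toReal = cross a b c / 2 := by
    rw [hH, volume_convexHull_triple, abs_of_pos hpos, ENNReal.toReal_ofReal (by linarith)]
  have hconv : Convex ℝ (hull K) := convex_convexHull ℝ _
  have hcpt : IsCompact (hull K) := K.finite_toSet.isCompact_convexHull (𝕜 := ℝ)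
  have hvert : ∀ x ∈ K, x ∈ hull K := fun x hx => subset_convexHull ℝ _ hx
  have haK := hvert a ((hmem a).2 (by simp))
  have hbK := hvert b ((hmem b).2 (by simp))
  have hcK := hvert c ((hmem c).2 (by simp))
  have hzK : z ∈ hull K := interior_subset hz
  have hdist : ∀ x ∈ hull K, ∀ y ∈ hull K, ‖x - y‖ ≤ h := fun x hx y hy => by
    rw [← dist_eq_norm]; exact (Metric.dist_le_diam_of_mem hcpt.isBounded hx hy).trans hdiam
  have hzab : 0 < cross a b z := cross_pos_of_mem_interior hpos (hH ▸ hz)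
  have hzbc : 0 < cross b c z := cross_pos_of_mem_interior (c := a) (by rwa [cross_rotate]) (by
    rw [hH] at hz; convert hz using 3; ext x; simp; tauto)
  have hzca : 0 < cross c a z := cross_pos_of_mem_interior (c := b)
    (by rwa [cross_rotate, cross_rotate]) (by
    rw [hH] at hz; convert hz using 3; ext x; simp; tauto)
  have hη : 0 ≤ η := (abs_nonneg _).trans (hosc z hz)
  have hh : 0 ≤ h := Metric.diam_nonneg.trans hdiam
  have hflux : ∀ p q, 0 < cross p q z → p ∈ hull K → q ∈ hull K → p ≠ q →
      ∑ pq ∈ ({p, q} : Finset Plane).offDiag, sideFlux α u pq.1 pq.2 z =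
      segmentMean α p z * inner ℝ g (rot (z - p)) - segmentMean α q z * inner ℝ g (rot (z - q)) := by
    intro p q hc hp hq hpq
    rw [sum_offDiag_pair hpq, sideFlux_eq hconv hp hz hu, sideFlux_eq hconv hq hz hu,
      norm_smul_outerNormal_of_pos hc, norm_smul_outerNormal_of_neg hc, inner_neg_right]
    ring
  have hvmid : ∀ p q, p ∈ K → q ∈ K → p ≠ q →
      v (mid {p, q}) = (inner ℝ d p + inner ℝ d q) / 2 + k := by
    intro p q hp hq hpq
    rw [hv _ (Finset.mem_powersetCard.2 ⟨by simp [Finset.insert_subset_iff, hp, hq],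
      Finset.card_pair hpq⟩), mid, Finset.sum_pair hpq, inner_smul_right, inner_add_right]
    ring
  have haM := (hmem a).2 (by simp)
  have hbM := (hmem b).2 (by simp)
  have hcM := (hmem c).2 (by simp)
  rw [sum_powersetCard_two hmem hpos, hflux a b hzab haK hbK hab, hflux b c hzbc hbK hcK hbc,
    hflux c a hzca hcK haK hca, hvmid a b haM hbM hab, hvmid b c hbM hcM hbc, hvmid c a hcM haM hca]
  have hI := abs_setIntegral_sub_le (κ := α z) (η := η) hcpt.measure_ne_top hint (by
      have := hconv.addHaar_frontier volume
      filter_upwards [ae_restrict_mem hcpt.measurableSet,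
        ae_restrict_of_ae (measure_eq_zero_iff_ae_notMem.1 this)] with x hx hx'
      refine hosc x ?_
      rw [frontier, hcpt.isClosed.closure_eq] at hx'
      by_contra hcon
      exact hx' ⟨hx, hcon⟩)
  have hid := sum_inner_rot_mul_inner a b c z g d
  have ba := abs_segmentMean_sub_le hconv haK hz hα hosc
  have bb := abs_segmentMean_sub_le hconv hbK hz hα hosc
  have bc := abs_segmentMean_sub_le hconv hcK hz hα hosc
  have hterm : ∀ (p q r : Plane) (m : ℝ), p ∈ hull K → q ∈ hull K → r ∈ hull K → |m| ≤ η →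
      |m * (inner ℝ g (rot (z - p)) * inner ℝ d (q - r))| ≤ η * h ^ 2 * (‖g‖ * ‖d‖) := by
    intro p q r m hp hq hr hm
    have h1 : |inner ℝ g (rot (z - p))| ≤ ‖g‖ * h := (abs_real_inner_le_norm _ _).trans (by
      rw [norm_rot]; exact mul_le_mul_of_nonneg_left (hdist z hzK p hp) (norm_nonneg _))
    have h2 : |inner ℝ d (q - r)| ≤ ‖d‖ * h := (abs_real_inner_le_norm _ _).trans
      (mul_le_mul_of_nonneg_left (hdist q hq r hr) (norm_nonneg _))
    rw [abs_mul, abs_mul]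
    calc _ ≤ η * ((‖g‖ * h) * (‖d‖ * h)) := by gcongr
      _ = _ := by ring
  have ta := hterm a b c _ haK hbK hcK ba
  have tb := hterm b c a _ hbK hcK haK bb
  have tc := hterm c a b _ hcK haK hbK bc
  have tI : |((∫ x in hull K, α x) - α z * (volume (hull K)).toReal) * inner ℝ g d| ≤
      η * (volume (hull K)).toReal * (‖g‖ * ‖d‖) := by
    rw [abs_mul]
    exact mul_le_mul hI (abs_real_inner_le_norm _ _) (abs_nonneg _) (by positivity)
  rw [hvol] at tI ⊢
  simp only [inner_sub_right d] at ta tb tc hid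
  rw [abs_le] at ta tb tc tI ⊢
  generalize inner ℝ g (rot (z - a)) = ga at *
  generalize inner ℝ g (rot (z - b)) = gb at *
  generalize inner ℝ g (rot (z - c)) = gc at *
  generalize segmentMean α a z = sa at *
  generalize segmentMean α b z = sb at *
  generalize segmentMean α c z = sc at *
  generalize inner ℝ d a = da at *
  generalize inner ℝ d b = db at *
  generalize inner ℝ d c = dc at *
  generalize inner ℝ g d = gd at *
  generalize (∫ x in hull K, α x) = I at *
  -- With the constant-coefficient identity scaled by `α z`, the quantity to bound is the sum of the
  -- term in `tI` and half of those in `ta`, `tb`, `tc`.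
  have hid' := congrArg (α z * ·) hid
  beta_reduce at hid'
  constructor
  · linarith [ta.1, tb.1, tc.1, tI.1]
  · linarith [ta.2, tb.2, tc.2, tI.2]

/-! ### Triangulations, coefficients and Crouzeix–Raviart functions -/

theorem isCompact_hull (K : Finset Plane) : IsCompact (hull K) :=
  K.finite_toSet.isCompact_convexHull (𝕜 := ℝ)

theorem convex_hull (K : Finset Plane) : Convex ℝ (hull K) := convex_convexHull ℝ _

theorem interior_hull_ae_eq (K : Finset Plane) : interior (hull K) =ᵐ[volume] hull K :=
  interior_ae_eq_of_null_frontier ((convex_hull K).addHaar_frontier volume)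

section

variable {Ω : Set Plane} {n : ℕ} {D : Fin n → Set Plane} {α : Plane → ℝ} {L ρ : ℝ}
  {T : Triangulation Ω} {z : Finset Plane → Plane} {K : Finset Plane}

theorem Triangulation.diam_le_meshSize (T : Triangulation Ω) (hK : K ∈ T.cells) :
    Metric.diam (hull K) ≤ T.meshSize :=
  le_ciSup (f := fun K : T.cells => Metric.diam (hull K.1)) (Set.finite_range _).bddAbove ⟨K, hK⟩

theorem Triangulation.hull_subset (T : Triangulation Ω) (hK : K ∈ T.cells) :
    hull K ⊆ closure Ω := by
  rw [← T.cover]; exact Set.subset_biUnion_of_mem (u := fun K => hull K) hK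

theorem Triangulation.meshSize_nonneg (T : Triangulation Ω) : 0 ≤ T.meshSize :=
  Real.iSup_nonneg fun _ => Metric.diam_nonneg

theorem Triangulation.meshSize_le (T : Triangulation Ω) (hΩ : Bornology.IsBounded Ω) :
    T.meshSize ≤ Metric.diam (closure Ω) :=
  Real.iSup_le (fun K => Metric.diam_mono (T.hull_subset K.2) hΩ.closure) Metric.diam_nonneg

/-- The connected interior avoids the frontier of `D j`, hence is covered by `D j` and the
complement of its closure; it lies in the piece whose closure contains `z K`. -/
theorem Triangulation.IsAligned.exists_interior_subset (hT : T.IsAligned D)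
    (hD : IsPartition Ω D) (hz : T.IsInteriorChoice z) (hK : K ∈ T.cells) :
    ∃ j, interior (hull K) ⊆ D j := by
  have hzK := hz K hK
  have h1 : z K ∈ ⋃ j, closure (D j) := by
    rw [hD.cover]; exact T.hull_subset hK (interior_subset hzK)
  obtain ⟨j, hj⟩ := Set.mem_iUnion.1 h1
  have hcl : ∀ x ∈ interior (hull K), x ∈ closure (D j) → x ∈ D j := by
    intro x hx hxc
    by_contra hxD
    exact Set.disjoint_left.1 (hT K hK j) hx (by
      rw [(hD.isOpen j).frontier_eq]; exact ⟨hxc, hxD⟩)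
  refine ⟨j, (convex_hull K).interior.isPreconnected.subset_left_of_subset_union (hD.isOpen j)
    isClosed_closure.isOpen_compl (v := (closure (D j))ᶜ) ?_ ?_ ⟨z K, hzK, hcl _ hzK hj⟩⟩
  · exact Set.disjoint_left.2 fun x hx hx' => hx' (subset_closure hx)
  · intro x hx
    by_cases hxc : x ∈ closure (D j)
    · exact Or.inl (hcl x hx hxc)
    · exact Or.inr hxc

theorem IsCoefficient.integrableOn {j : Fin n} (hα : IsCoefficient D α L)
    (hj : interior (hull K) ⊆ D j) : IntegrableOn α (hull K) := by
  rw [← integrableOn_congr_set_ae (interior_hull_ae_eq K)]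
  have : IsFiniteMeasure (volume.restrict (interior (hull K))) :=
    ⟨by
      rw [Measure.restrict_apply_univ]
      exact (measure_mono interior_subset).trans_lt (isCompact_hull K).measure_lt_top⟩
  exact ((hα.memW j).1.mono_measure (Measure.restrict_mono hj le_rfl)).integrable le_top

theorem IsCoefficient.abs_sub_le {j : Fin n} (hD : IsPartition Ω D) (hα : IsCoefficient D α L)
    {x y : Plane} (hxy : segment ℝ x y ⊆ D j) : |α y - α x| ≤ 2 * max L 0 * ‖y - x‖ := by
  obtain ⟨g, hg⟩ := (hα.memW j).2
  refine abs_sub_le_of_isWeakPartial (hD.isOpen j) (le_max_right _ _) (hα.continuousOn j)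
    (hα.memW j).1 (fun i => (hg i).1) (fun i => (hg i).2.2.trans ?_) hxy
  exact ENNReal.ofReal_le_ofReal (le_max_left _ _)

theorem IsCoefficient.volume_le_integral {j : Fin n} (hα : IsCoefficient D α L)
    (hj : interior (hull K) ⊆ D j) : (volume (hull K)).toReal ≤ ∫ x in hull K, α x := by
  have h1 : (volume (hull K)).toReal = ∫ _ in hull K, (1 : ℝ) := by
    rw [setIntegral_const, smul_eq_mul, mul_one]; rfl
  rw [h1]
  have hK1 : IntegrableOn (fun _ : Plane => (1 : ℝ)) (hull K) :=
    integrableOn_const ((isCompact_hull K).measure_ne_top (μ := volume))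
  refine integral_mono_ae hK1
    (hα.integrableOn hj) ?_
  rw [← Measure.restrict_congr_set (interior_hull_ae_eq K)]
  filter_upwards [ae_restrict_mem isOpen_interior.measurableSet] with x hx
  exact hα.one_le j x (hj hx)

/-- The triangle contains a disc of radius at least `ρ h / 2`, whose area is at least `π ρ ^ 2 h ^ 2
/ 4`. -/
theorem Triangulation.IsQuasiuniform.meshSize_sq_le (hT : T.IsQuasiuniform ρ) (hρ : 0 < ρ)
    (hK : K ∈ T.cells) :
    T.meshSize ^ 2 ≤ 4 / (Real.pi * ρ ^ 2) * (volume (hull K)).toReal := by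
  obtain ⟨c, r, hr, hball⟩ := hT K hK
  have hr0 : 0 ≤ r := by nlinarith [mul_nonneg hρ.le T.meshSize_nonneg]
  have hvol : r ^ 2 * Real.pi ≤ (volume (hull K)).toReal := by
    have h1 := ENNReal.toReal_mono ((isCompact_hull K).measure_ne_top (μ := volume))
      (measure_mono hball)
    rw [EuclideanSpace.volume_closedBall_fin_two] at h1
    simpa [hr0, Real.pi_pos.le] using h1
  have h2 : (ρ * T.meshSize) ^ 2 ≤ (2 * r) ^ 2 :=
    pow_le_pow_left₀ (mul_nonneg hρ.le T.meshSize_nonneg) hr 2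
  have hpi := Real.pi_pos
  rw [div_mul_eq_mul_div, le_div_iff₀ (by positivity)]
  nlinarith

theorem Triangulation.IsCR.exists_inner {u : Plane → ℝ} (hu : T.IsCR u) (hK : K ∈ T.cells) :
    ∃ (g : Plane) (k : ℝ), (∀ x ∈ interior (hull K), gradient u x = g) ∧
      ∀ e ∈ K.powersetCard 2, u (mid e) = inner ℝ g (mid e) + k := by
  obtain ⟨A, hA, hAm⟩ := hu.1 K hK
  let g : Plane := (InnerProductSpace.toDual ℝ Plane).symm A.linear.toContinuousLinearMap
  have hg : ∀ x, A x = inner ℝ g x + A 0 := fun x => by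
    rw [InnerProductSpace.toDual_symm_apply]
    have := congrFun A.decomp x
    simpa using this
  refine ⟨g, A 0, fun x hx => ?_, fun e he => by rw [hAm e he, hg]⟩
  have h1 : HasGradientAt (fun y => inner ℝ g y + A 0) g x := by
    rw [hasGradientAt_iff_hasFDerivAt]
    exact ((InnerProductSpace.toDual ℝ Plane g).hasFDerivAt).add_const _
  refine (h1.congr_of_eventuallyEq ?_).gradient
  filter_upwards [isOpen_interior.mem_nhds hx] with y hy
  rw [hA y hy, hg]

theorem Triangulation.aFE_eq (hz : T.IsInteriorChoice z) {u v : Plane → ℝ} (hu : T.IsCR u)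
    (hv : T.IsCR v) :
    T.aFE α u v = ∑ K ∈ T.cells,
      (∫ x in hull K, α x) * inner ℝ (gradient u (z K)) (gradient v (z K)) := by
  refine Finset.sum_congr rfl fun K hK => ?_
  obtain ⟨g, k, hg, -⟩ := hu.exists_inner hK
  obtain ⟨d, l, hd, -⟩ := hv.exists_inner hK
  rw [hg _ (hz K hK), hd _ (hz K hK), ← integral_mul_const,
    ← Measure.restrict_congr_set (interior_hull_ae_eq K)]
  refine setIntegral_congr_fun isOpen_interior.measurableSet fun x hx => ?_
  simp only [hg x hx, hd x hx]

/-! ### Midpoints in control volumes and cellwise summation -/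

theorem Triangulation.mem_edges {e : Finset Plane} :
    e ∈ T.edges ↔ ∃ K ∈ T.cells, e ∈ K.powersetCard 2 := by
  classical
  simp [Triangulation.edges]

theorem Triangulation.mid_mem_convexHull {e : Finset Plane} (he : e.card = 2) :
    mid e ∈ hull e := by
  classical
  obtain ⟨p, q, hpq, rfl⟩ := Finset.card_eq_two.1 he
  rw [mid, Finset.sum_pair hpq, smul_add]
  exact (convex_hull _) (subset_convexHull ℝ _ (by simp)) (subset_convexHull ℝ _ (by simp))
    (by norm_num) (by norm_num) (by norm_num)

theorem Triangulation.mid_mem_controlVolume {e : Finset Plane} (he : e ∈ T.edges) :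
    mid e ∈ T.controlVolume z e := by
  classical
  obtain ⟨K, hK, heK⟩ := T.mem_edges.1 he
  obtain ⟨hsub, hcard⟩ := Finset.mem_powersetCard.1 heK
  refine Set.mem_biUnion (x := K) (by simp [Triangulation.cellsAt, hK, hsub]) ?_
  exact convexHull_mono Set.subset_union_left (mid_mem_convexHull hcard)

/-- If `mid e` lay in a triangle `K` with edge `e'`, conformity would make `e` an edge of `K` as
well, and `mid_notMem_of_ne` separates two edges of the same triangle. Thus `dualInterp` reproduces
the midpoint values. -/
theorem Triangulation.mid_notMem_controlVolume (hz : T.IsInteriorChoice z) {e e' : Finset Plane}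
    (he : e ∈ T.edges) (he' : e' ∈ T.edges) (hne : e ≠ e') :
    mid e ∉ T.controlVolume z e' := by
  classical
  intro hm
  obtain ⟨K, hK, hmK⟩ := Set.mem_iUnion₂.1 hm
  obtain ⟨hK, he'K⟩ : K ∈ T.cells ∧ e' ⊆ K := by simpa [Triangulation.cellsAt] using hK
  obtain ⟨K₁, hK₁, heK₁⟩ := T.mem_edges.1 he
  obtain ⟨heK₁s, hcard⟩ := Finset.mem_powersetCard.1 heK₁
  have hcard' : e'.card = 2 := by
    obtain ⟨_, _, h⟩ := T.mem_edges.1 he'; exact (Finset.mem_powersetCard.1 h).2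
  have hmhull : mid e ∈ hull K := by
    refine convexHull_min ?_ (convex_hull K) hmK
    rintro x (hx | rfl)
    · exact subset_convexHull ℝ _ (he'K hx)
    · exact interior_subset (hz K hK)
  have hmhull₁ : mid e ∈ hull K₁ := convexHull_mono heK₁s (mid_mem_convexHull hcard)
  have heK : e ⊆ K := edge_subset_of_mid_mem (T.card_eq K₁ hK₁) (T.indep K₁ hK₁) heK₁
    (T.inter_subset K₁ hK₁ K hK ⟨hmhull₁, hmhull⟩)
  obtain ⟨r, hr⟩ : ∃ r, K \ e = {r} := Finset.card_eq_one.1 (by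
    rw [Finset.card_sdiff_of_subset heK, hcard, T.card_eq K hK])
  have hr_mem : r ∈ K \ e := by simp [hr]
  obtain ⟨hrK, hre⟩ := Finset.mem_sdiff.1 hr_mem
  have hKmem : ∀ x ∈ K, x ∈ e ∨ x = r := fun x hx => by
    by_cases hxe : x ∈ e
    · exact Or.inl hxe
    · have : x ∈ K \ e := Finset.mem_sdiff.2 ⟨hx, hxe⟩
      rw [hr] at this
      exact Or.inr (Finset.mem_singleton.1 this)
  have hre' : r ∈ e' := by
    by_contra hcon
    have : e' ⊆ e := fun x hx => (hKmem x (he'K hx)).resolve_right fun h => hcon (h ▸ hx)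
    exact hne (Finset.eq_of_subset_of_card_le this (by rw [hcard, hcard'])).symm
  obtain ⟨p, hp⟩ : ∃ p, e'.erase r = {p} := Finset.card_eq_one.1 (by
    rw [Finset.card_erase_of_mem hre', hcard'])
  have hpe' : p ∈ e'.erase r := by simp [hp]
  have hpe : p ∈ e := (hKmem p (he'K (Finset.mem_erase.1 hpe').2)).resolve_right
    (Finset.mem_erase.1 hpe').1
  obtain ⟨a, b, hab, rfl⟩ := Finset.card_eq_two.1 hcard
  have hset : ((e' : Set Plane) ∪ {z K}) = {p, r, z K} := by
    rw [← Finset.insert_erase hre', hp]; ext x; simp; tauto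
  rw [hset, mid, Finset.sum_pair hab] at hmK
  have haK : a ∈ K := heK (by simp)
  have hbK : b ∈ K := heK (by simp)
  have har : a ≠ r := fun h => hre (by simp [← h])
  have hbr : b ≠ r := fun h => hre (by simp [← h])
  have hpab : p = a ∨ p = b := by simpa using hpe
  have hKab : ∀ x, x ∈ K ↔ x = a ∨ x = b ∨ x = r := fun x => by
    constructor
    · intro hx; have := hKmem x hx; simp at this; tauto
    · rintro (rfl | rfl | rfl) <;> assumption
  have hzK := hz K hK
  rcases lt_or_gt_of_ne (cross_ne_zero (T.indep K hK) haK hbK hrK hab har hbr) with h | h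
  · rw [hull_eq_triple (a := b) (b := a) (c := r) (fun x => by rw [hKab]; tauto)] at hzK
    rw [add_comm] at hmK
    exact mid_notMem_of_ne (by rw [cross_swap]; linarith) hzK hpab.symm hmK
  · rw [hull_eq_triple hKab] at hzK
    exact mid_notMem_of_ne h hzK hpab hmK

theorem Triangulation.dualInterp_mid (hz : T.IsInteriorChoice z) (v : Plane → ℝ) {e : Finset Plane}
    (he : e ∈ T.interiorEdges) : T.dualInterp z v (mid e) = v (mid e) := by
  classical
  have hmem : ∀ {e}, e ∈ T.interiorEdges → e ∈ T.edges := fun h => (Finset.mem_filter.1 h).1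
  rw [Triangulation.dualInterp, Finset.sum_eq_single_of_mem e he]
  · rw [Set.indicator_of_mem (T.mid_mem_controlVolume (hmem he)), mul_one]
  · intro e' he' hne
    rw [Set.indicator_of_notMem (T.mid_notMem_controlVolume hz (hmem he) (hmem he') hne.symm),
      mul_zero]

open scoped Classical in
-- Since `v` vanishes at the midpoints of boundary edges, the sum extends to all edges and can then
-- be regrouped by triangles.
theorem Triangulation.aFV_dualInterp (hz : T.IsInteriorChoice z) {u v : Plane → ℝ}
    (hv : T.IsCR v) :
    T.aFV z α u (T.dualInterp z v) = -∑ K ∈ T.cells, ∑ e ∈ K.powersetCard 2,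
      v (mid e) * ∑ pq ∈ e.offDiag, sideFlux α u pq.1 pq.2 (z K) := by
  rw [Triangulation.aFV, neg_inj]
  have h1 : ∑ e ∈ T.interiorEdges, T.dualInterp z v (mid e) * T.boundaryFlux z α u e =
      ∑ e ∈ T.edges, v (mid e) * T.boundaryFlux z α u e := by
    rw [Finset.sum_congr rfl fun e he => by rw [T.dualInterp_mid hz v he]]
    refine Finset.sum_subset (Finset.filter_subset _ _) fun e he hne => ?_
    have : hull e ⊆ frontier Ω := by
      by_contra hcon; exact hne (Finset.mem_filter.2 ⟨he, hcon⟩)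
    rw [hv.2 e he this, zero_mul]
  rw [h1]
  simp_rw [Triangulation.boundaryFlux, Finset.mul_sum (s := T.cellsAt _)]
  refine Finset.sum_comm' fun e K => ?_
  rw [T.mem_edges, Triangulation.cellsAt, Finset.mem_filter]
  constructor
  · rintro ⟨⟨K', -, he⟩, hK, hs⟩
    exact ⟨Finset.mem_powersetCard.2 ⟨hs, (Finset.mem_powersetCard.1 he).2⟩, hK⟩
  · rintro ⟨he, hK⟩
    exact ⟨⟨K, hK, he⟩, hK, (Finset.mem_powersetCard.1 he).1⟩

/-! ### Energy norm and global estimates -/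

theorem Triangulation.energyNorm_eq (hz : T.IsInteriorChoice z) {u : Plane → ℝ} (hu : T.IsCR u) :
    T.energyNorm α u = √(∑ K ∈ T.cells, (∫ x in hull K, α x) * ‖gradient u (z K)‖ ^ 2) := by
  rw [Triangulation.energyNorm, T.aFE_eq hz hu hu]
  simp_rw [real_inner_self_eq_norm_sq]

theorem Triangulation.sum_norm_mul_norm_le (hz : T.IsInteriorChoice z) {u v : Plane → ℝ}
    (hu : T.IsCR u) (hv : T.IsCR v) (hα : ∀ K ∈ T.cells, 0 ≤ ∫ x in hull K, α x) :
    ∑ K ∈ T.cells, (∫ x in hull K, α x) * (‖gradient u (z K)‖ * ‖gradient v (z K)‖) ≤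
      T.energyNorm α u * T.energyNorm α v := by
  rw [T.energyNorm_eq hz hu, T.energyNorm_eq hz hv]
  have hsq : ∀ w : Plane → ℝ, ∑ K ∈ T.cells, (∫ x in hull K, α x) * ‖gradient w (z K)‖ ^ 2 =
      ∑ K ∈ T.cells, (√(∫ x in hull K, α x) * ‖gradient w (z K)‖) ^ 2 := fun w =>
    Finset.sum_congr rfl fun K hK => by rw [mul_pow, Real.sq_sqrt (hα K hK)]
  rw [hsq, hsq]
  refine le_of_eq_of_le (Finset.sum_congr rfl fun K hK => ?_)
    (Real.sum_mul_le_sqrt_mul_sqrt T.cells _ _)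
  rw [mul_mul_mul_comm, Real.mul_self_sqrt (hα K hK)]

/-- The factor in front of `h` in the comparison of the two forms. -/
noncomputable def perturbationConst (L ρ : ℝ) : ℝ :=
  2 * max L 0 * (1 + 3 / 2 * (4 / (Real.pi * ρ ^ 2)))

theorem Triangulation.abs_aFE_sub_aFV_le (hD : IsPartition Ω D) (hα : IsCoefficient D α L)
    (hρ : 0 < ρ) (hq : T.IsQuasiuniform ρ) (ha : T.IsAligned D) (hz : T.IsInteriorChoice z)
    {u v : Plane → ℝ} (hu : T.IsCR u) (hv : T.IsCR v) :
    |T.aFE α u v - T.aFV z α u (T.dualInterp z v)| ≤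
      perturbationConst L ρ * T.meshSize * (T.energyNorm α u * T.energyNorm α v) := by
  classical
  have hpos : ∀ K ∈ T.cells, 0 ≤ ∫ x in hull K, α x := fun K hK => by
    obtain ⟨j, hj⟩ := ha.exists_interior_subset hD hz hK
    exact ENNReal.toReal_nonneg.trans (hα.volume_le_integral hj)
  have hc : 0 ≤ perturbationConst L ρ := by
    have := le_max_right L 0
    have := Real.pi_pos
    unfold perturbationConst; positivity
  have hm := T.meshSize_nonneg
  refine le_trans ?_ (mul_le_mul_of_nonneg_left (T.sum_norm_mul_norm_le hz hu hv hpos)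
    (mul_nonneg hc hm))
  rw [T.aFE_eq hz hu hv, T.aFV_dualInterp hz hv, sub_neg_eq_add, ← Finset.sum_add_distrib,
    Finset.mul_sum]
  refine (Finset.abs_sum_le_sum_abs _ _).trans (Finset.sum_le_sum fun K hK => ?_)
  obtain ⟨j, hj⟩ := ha.exists_interior_subset hD hz hK
  obtain ⟨g, k, hg, -⟩ := hu.exists_inner hK
  obtain ⟨d, l, hd, hdm⟩ := hv.exists_inner hK
  have hzK := hz K hK
  rw [hg _ hzK, hd _ hzK]
  have hM : 0 ≤ 2 * max L 0 := by have := le_max_right L 0; positivity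
  have hosc : ∀ x ∈ interior (hull K), |α x - α (z K)| ≤ 2 * max L 0 * T.meshSize := by
    intro x hx
    refine (hα.abs_sub_le hD (((convex_hull K).interior.segment_subset hzK hx).trans hj)).trans ?_
    refine mul_le_mul_of_nonneg_left ?_ hM
    rw [← dist_eq_norm]
    exact (Metric.dist_le_diam_of_mem (isCompact_hull K).isBounded (interior_subset hx)
      (interior_subset hzK)).trans (T.diam_le_meshSize hK)
  refine (abs_integral_add_flux_le (T.card_eq K hK) (T.indep K hK) hzK
    ((hα.continuousOn j).mono hj) (hα.integrableOn hj) hosc (T.diam_le_meshSize hK) hg hdm).trans ?_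
  have h1 := hq.meshSize_sq_le hρ hK
  have h2 := hα.volume_le_integral hj
  have hpi := Real.pi_pos
  -- First `h ^ 2` is traded for the area by quasiuniformity, then the area for the integral of `α ≥
  -- 1`.
  calc 2 * max L 0 * T.meshSize * ((volume (hull K)).toReal + 3 / 2 * T.meshSize ^ 2)
        * (‖g‖ * ‖d‖)
      ≤ 2 * max L 0 * T.meshSize * ((volume (hull K)).toReal +
        3 / 2 * (4 / (Real.pi * ρ ^ 2) * (volume (hull K)).toReal)) * (‖g‖ * ‖d‖) := by gcongr
    _ = perturbationConst L ρ * T.meshSize * ((volume (hull K)).toReal * (‖g‖ * ‖d‖)) := by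
        unfold perturbationConst; ring
    _ ≤ _ := by gcongr

theorem Triangulation.abs_aFE_le (hD : IsPartition Ω D) (hα : IsCoefficient D α L)
    (ha : T.IsAligned D) (hz : T.IsInteriorChoice z)
    {u v : Plane → ℝ} (hu : T.IsCR u) (hv : T.IsCR v) :
    |T.aFE α u v| ≤ T.energyNorm α u * T.energyNorm α v := by
  have hpos : ∀ K ∈ T.cells, 0 ≤ ∫ x in hull K, α x := fun K hK => by
    obtain ⟨j, hj⟩ := ha.exists_interior_subset hD hz hK
    exact ENNReal.toReal_nonneg.trans (hα.volume_le_integral hj)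
  refine le_trans ?_ (T.sum_norm_mul_norm_le hz hu hv hpos)
  rw [T.aFE_eq hz hu hv]
  refine (Finset.abs_sum_le_sum_abs _ _).trans (Finset.sum_le_sum fun K hK => ?_)
  rw [abs_mul, abs_of_nonneg (hpos K hK)]
  exact mul_le_mul_of_nonneg_left (abs_real_inner_le_norm _ _) (hpos K hK)

theorem Triangulation.energyNorm_sq (hD : IsPartition Ω D) (hα : IsCoefficient D α L)
    (ha : T.IsAligned D) (hz : T.IsInteriorChoice z) {u : Plane → ℝ} (hu : T.IsCR u) :
    T.energyNorm α u ^ 2 = T.aFE α u u := by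
  refine Real.sq_sqrt ?_
  rw [T.aFE_eq hz hu hu]
  refine Finset.sum_nonneg fun K hK => ?_
  obtain ⟨j, hj⟩ := ha.exists_interior_subset hD hz hK
  exact mul_nonneg (ENNReal.toReal_nonneg.trans (hα.volume_le_integral hj)) real_inner_self_nonneg

end

end CRFVE

/-- The constants depend only on the domain, the bound `L` of the coefficient's seminorms and the
quasiuniformity parameter `ρ`. -/
theorem mainTheorem6 (Ω : Set CRFVE.Plane) (hΩ_open : IsOpen Ω) (hΩ_convex : Convex ℝ Ω)
    (hΩ_bdd : Bornology.IsBounded Ω) (hΩ_ne : Ω.Nonempty) (L ρ : ℝ) (hρ : 0 < ρ) :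
    ∃ C C₀ C₁ h₀ : ℝ, 0 < C ∧ 0 < C₀ ∧ 0 < C₁ ∧ 0 < h₀ ∧
      ∀ (n : ℕ) (D : Fin n → Set CRFVE.Plane) (α : CRFVE.Plane → ℝ),
        CRFVE.IsPartition Ω D → CRFVE.IsCoefficient D α L →
      ∀ (T : CRFVE.Triangulation Ω) (z : Finset CRFVE.Plane → CRFVE.Plane),
        T.IsQuasiuniform ρ → T.IsAligned D → T.IsInteriorChoice z →
        (∀ u v : CRFVE.Plane → ℝ, T.IsCR u → T.IsCR v →
          |T.aFE α u v - T.aFV z α u (T.dualInterp z v)| ≤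
            C * T.meshSize * T.energyNorm α u * T.energyNorm α v) ∧
        (∀ u v : CRFVE.Plane → ℝ, T.IsCR u → T.IsCR v →
          |T.aFV z α u (T.dualInterp z v)| ≤ C₁ * T.energyNorm α u * T.energyNorm α v) ∧
        (T.meshSize < h₀ → ∀ u : CRFVE.Plane → ℝ, T.IsCR u →
          C₀ * T.energyNorm α u ^ 2 ≤ T.aFV z α u (T.dualInterp z u)) := by
  have hP : 0 ≤ CRFVE.perturbationConst L ρ := by
    have := le_max_right L 0
    have := Real.pi_pos
    unfold CRFVE.perturbationConst; positivity
  -- The added `1` keeps `C` positive when `L ≤ 0`, where `perturbationConst` is zero.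
  set C := CRFVE.perturbationConst L ρ + 1 with hC
  have hC0 : 0 < C := by linarith
  have hd : 0 ≤ Metric.diam (closure Ω) := Metric.diam_nonneg
  -- `C₁` uses that the mesh size is at most the diameter of the domain; `h₀` makes the perturbation
  -- at most half of the squared energy norm.
  refine ⟨C, 1 / 2, 1 + C * Metric.diam (closure Ω), 1 / (2 * C), hC0, by norm_num, by positivity,
    by positivity, fun n D α hD hα T z hq ha hz => ?_⟩
  have hm := T.meshSize_nonneg
  have key : ∀ u v : CRFVE.Plane → ℝ, T.IsCR u → T.IsCR v →
      |T.aFE α u v - T.aFV z α u (T.dualInterp z v)| ≤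
        C * T.meshSize * (T.energyNorm α u * T.energyNorm α v) := by
    intro u v hu hv
    refine (T.abs_aFE_sub_aFV_le hD hα hρ hq ha hz hu hv).trans ?_
    have hu0 : 0 ≤ T.energyNorm α u := Real.sqrt_nonneg _
    have hv0 : 0 ≤ T.energyNorm α v := Real.sqrt_nonneg _
    gcongr
    linarith
  refine ⟨fun u v hu hv => ?_, fun u v hu hv => ?_, fun hh u hu => ?_⟩
  · rw [mul_assoc]; exact key u v hu hv
  · have h1 := key u v hu hv
    have h2 := CRFVE.Triangulation.abs_aFE_le hD hα ha hz hu hv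
    have h3 : C * T.meshSize * (T.energyNorm α u * T.energyNorm α v) ≤
        C * Metric.diam (closure Ω) * (T.energyNorm α u * T.energyNorm α v) := by
      have hu0 : 0 ≤ T.energyNorm α u := Real.sqrt_nonneg _
      have hv0 : 0 ≤ T.energyNorm α v := Real.sqrt_nonneg _
      have := T.meshSize_le hΩ_bdd
      gcongr
    rw [abs_le] at *
    constructor <;> linarith [h1.1, h1.2, h2.1, h2.2]
  · have h1 := (abs_le.1 (key u u hu hu)).2
    rw [← CRFVE.Triangulation.energyNorm_sq hD hα ha hz hu] at h1
    have h2 : C * T.meshSize ≤ 1 / 2 := by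
      rw [lt_div_iff₀ (by positivity)] at hh
      linarith
    nlinarith [mul_le_mul_of_nonneg_right h2 (sq_nonneg (T.energyNorm α u))]
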